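/- Let $p=(p_0,p_1,p_2,\ldots)$ be a probability distribution on $\{0,1,2,\ldots\}$ that is critical, i.e. $\sum_k k\,p_k=1$, and unbounded, i.e. the set $\{n : p_n>0\}$ is unbounded. Let $\mathbb T$ be the set of rooted ordered trees all of whose vertices have finite out-degree, i.e. of sets $\mathbf t$ of finite words of positive integers such that $\emptyset\in\mathbf t$, every prefix of a word of $\mathbf t$ is in $\mathbf t$, and for every $u\in\mathbf t$ there is an integer $k_u(\mathbf t)\ge 0$ (the out-degree of $u$) with $ui\in\mathbf t\iff 1\le i\le k_u(\mathbf t)$. Let $M(\mathbf t)=\sup\{k_u(\mathbf t):u\in\mathbf t\}\in\{0,1,2,\dots\}\cup\{+\infty\}$ be the maximal out-degree. Endow $\mathbb T$ with the local topology, generated by the sets $\{\mathbf s: r_h(\mathbf s)=r_h(\mathbf t)\}$ with $h\ge 0$ and $\mathbf t\in\mathbb T$, where $r_h(\mathbf t)$ is the set of words of $\mathbf t$ of length at most $h$, and with its Borel $\sigma$-field. Let $\tau$ be a Galton–Watson tree with offspring distribution $p$: a $\mathbb T$-valued random variable such that $\mathbb P(k_\emptyset(\tau)=n)=p_n$ for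 all $n\ge 0$ and such that, conditionally on $k_\emptyset(\tau)=n$, the $n$ sub-trees of $\tau$ above the children of the root are independent and distributed as $\tau$. Let $\tau^*(p)$ be Kesten's tree, the random tree whose vertices are either normal or special and which is grown as follows: the root is special; the offspring of all the vertices are independent; a normal vertex has $k$ children with probability $p_k$, all of them normal; a special vertex has $k$ children with probability $k\,p_k$, one of which, chosen uniformly at random, is special, the others being normal. Then $\mathbb P(M(\tau)=n)>0$ for every $n$ with $p_n>0$, and $\mathbb P(M(\tau)>n)>0$ for every $n\ge 0$; and, for the weak convergence of probability measures on $\mathbb T$, $$\operatorname{dist}(\tau\mid M(\tau)=n)\longrightarrow \operatorname{dist}(\tau^*(p))\qquad\text{as } n\to\infty \text{ along } \{n : p_n>0\},$$ $$\operatorname{dist}(\tau\mid M(\tau)>n)\longrightarrow \operatorname{dist}(\tau^*(p))\qquad\text{as } n\to\infty.$$ -/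

import Mathlib

open MeasureTheory ProbabilityTheory Filter Topology
open scoped ENNReal

noncomputable section

namespace GWTree

/-- A rooted ordered tree without infinite vertex. Vertices are finite words, the root being the
empty word; the children of `u` are the words `u ++ [i]`. Siblings are numbered from `0`, so that
`u ++ [i]` belongs to the tree iff `i < k_u`. -/
@[ext]
structure LFTree where
  carrier : Set (List ℕ)
  nil_mem : [] ∈ carrier
  ancestor_mem : ∀ u v : List ℕ, u ++ v ∈ carrier → u ∈ carrier
  exists_degree : ∀ u ∈ carrier, ∃ k : ℕ, ∀ i : ℕ, u ++ [i] ∈ carrier ↔ i < k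

namespace LFTree

/-- The out-degree `k_u(t)` of a vertex `u` of `t` (it is `0` for words outside `t`). -/
def outDegree (t : LFTree) (u : List ℕ) : ℕ := {i : ℕ | u ++ [i] ∈ t.carrier}.ncard

/-- The maximal out-degree `M(t) = sup {k_u(t) ; u ∈ t}`, possibly infinite. -/
def maxOutDegree (t : LFTree) : ℕ∞ := ⨆ u ∈ t.carrier, (t.outDegree u : ℕ∞)

/-- The sub-tree `S_u(t)` above a vertex `u` of `t`, re-rooted at `u`
(the tree reduced to its root if `u` is not a vertex of `t`). -/
def subtree (t : LFTree) (u : List ℕ) : LFTree where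
  carrier := {v | v = [] ∨ u ++ v ∈ t.carrier}
  nil_mem := Or.inl rfl
  ancestor_mem := by
    rintro v w (h | h)
    · exact Or.inl (List.append_eq_nil_iff.1 h).1
    · exact Or.inr (t.ancestor_mem (u ++ v) w (by simpa using h))
  exists_degree := by
    intro v _
    by_cases h : u ++ v ∈ t.carrier
    · obtain ⟨k, hk⟩ := t.exists_degree _ h
      exact ⟨k, fun i => by simpa using hk i⟩
    · refine ⟨0, fun i => ?_⟩
      have : u ++ (v ++ [i]) ∉ t.carrier := fun h' =>
        h (t.ancestor_mem (u ++ v) [i] (by simpa using h'))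
      simp [this]

/-- The restriction `r_h(t)` of `t` to its first `h` generations, as a set of vertices. -/
def restr (h : ℕ) (t : LFTree) : Set (List ℕ) := {u ∈ t.carrier | u.length ≤ h}

/-- The topology of local convergence: its basic open sets are the balls
`{s ; r_h(s) = r_h(t)}` of the distance `2 ^ (- sup {h ; r_h(s) = r_h(t)})`. -/
instance : TopologicalSpace LFTree :=
  TopologicalSpace.generateFrom {B | ∃ (h : ℕ) (t : LFTree), B = {s | restr h s = restr h t}}

instance : MeasurableSpace LFTree := borel LFTree

instance : BorelSpace LFTree := ⟨rfl⟩

end LFTree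

/-- The mean `∑ k p_k` of an offspring distribution. -/
def mean (p : PMF ℕ) : ℝ≥0∞ := ∑' k : ℕ, (k : ℝ≥0∞) * p k

/-- `p` is critical if its mean is `1`. -/
def IsCritical (p : PMF ℕ) : Prop := mean p = 1

/-- `p` is unbounded if `{n ; p_n > 0}` is unbounded. -/
def IsUnbounded (p : PMF ℕ) : Prop := ¬ BddAbove {n : ℕ | 0 < p n}

/-- The random tree `τ` is a Galton-Watson tree with offspring distribution `p`: the root has
`n` children with probability `p n` and, conditionally on this event, the `n` sub-trees above the
children of the root are independent and distributed as `τ`. -/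
structure IsGaltonWatson {Ω : Type*} [MeasurableSpace Ω] (p : PMF ℕ) (P : Measure Ω)
    (τ : Ω → LFTree) : Prop where
  measurable : Measurable τ
  root : ∀ n : ℕ, P {ω | (τ ω).outDegree [] = n} = p n
  branching : ∀ (n : ℕ) (A : Fin n → Set LFTree), (∀ i, MeasurableSet (A i)) →
    P {ω | (τ ω).outDegree [] = n ∧ ∀ i : Fin n, (τ ω).subtree [(i : ℕ)] ∈ A i}
      = P {ω | (τ ω).outDegree [] = n} * ∏ i, P {ω | τ ω ∈ A i}

/-- The vertices of the tree in which each vertex `u` has `κ u` children. -/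
inductive Grown (κ : List ℕ → ℕ) : List ℕ → Prop
  | root : Grown κ []
  | child (u : List ℕ) (i : ℕ) : Grown κ u → i < κ u → Grown κ (u ++ [i])

theorem grown_append_singleton (κ : List ℕ → ℕ) (u : List ℕ) (i : ℕ) :
    Grown κ (u ++ [i]) ↔ Grown κ u ∧ i < κ u := by
  refine ⟨fun h => ?_, fun h => Grown.child u i h.1 h.2⟩
  generalize hw : u ++ [i] = w at h
  cases h with
  | root => simp at hw
  | child v j hv hj =>
    obtain ⟨rfl, hij⟩ := List.append_inj' hw rfl
    obtain rfl : i = j := by simpa using hij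
    exact ⟨hv, hj⟩

/-- The tree in which each vertex `u` has `κ u` children. -/
def treeOf (κ : List ℕ → ℕ) : LFTree where
  carrier := {u | Grown κ u}
  nil_mem := Grown.root
  ancestor_mem := by
    intro u v
    induction v using List.reverseRecOn with
    | nil => simp
    | append_singleton v i ih =>
      intro h
      rw [← List.append_assoc] at h
      exact ih ((grown_append_singleton κ _ i).1 h).1
  exists_degree := fun u hu => ⟨κ u, fun i => by
    have hu' : Grown κ u := hu
    simp [grown_append_singleton, hu']⟩

/-- The size-biased distribution `k p_k` of a critical offspring distribution. -/
def sizeBiased (p : PMF ℕ) (hp : IsCritical p) : PMF ℕ :=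
  ⟨fun k => (k : ℝ≥0∞) * p k, by
    have h : ∑' k : ℕ, (k : ℝ≥0∞) * p k = 1 := hp
    exact h ▸ ENNReal.summable.hasSum⟩

/-- The uniform choice of one of `k` children (irrelevant for `k = 0`). -/
def uniformChild : ℕ → PMF ℕ
  | 0 => PMF.pure 0
  | k + 1 => PMF.uniformOfFinset (Finset.range (k + 1)) ⟨0, by simp⟩

/-- The joint law of the number of children of a special vertex, and of the index of its child
that is special. -/
def specialOffspring (p : PMF ℕ) (hp : IsCritical p) : PMF (ℕ × ℕ) :=
  (sizeBiased p hp).bind fun k => (uniformChild k).map fun j => (k, j)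

/-- To every word `u` is attached a triple `(N, K, J)`: `N` is the number of children of `u` if `u`
is normal; if `u` is special, `K` is its number of children and `J` is the index of the special
one among them. -/
abbrev Labels : Type := List ℕ → ℕ × ℕ × ℕ

/-- The labels of distinct words are independent; `N` has law `p` and `(K, J)` is the offspring of a
special vertex. -/
def labelLaw (p : PMF ℕ) (hp : IsCritical p) : Measure Labels :=
  Measure.infinitePi fun _ : List ℕ => p.toMeasure.prod (specialOffspring p hp).toMeasure

/-- The special words: the root is special, and exactly one child of a special word is special,
while the children of a normal word are normal. -/
inductive IsSpecial (ω : Labels) : List ℕ → Prop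
  | root : IsSpecial ω []
  | child (u : List ℕ) : IsSpecial ω u → IsSpecial ω (u ++ [(ω u).2.2])

open Classical in
/-- The number of children of `u` in Kesten's tree. -/
def kestenDegree (ω : Labels) (u : List ℕ) : ℕ :=
  if IsSpecial ω u then (ω u).2.1 else (ω u).1

/-- Kesten's tree, as a function of the labels. -/
def kestenTree (ω : Labels) : LFTree := treeOf (kestenDegree ω)

theorem isSpecial_append_singleton (ω : Labels) (u : List ℕ) (i : ℕ) :
    IsSpecial ω (u ++ [i]) ↔ IsSpecial ω u ∧ i = (ω u).2.2 := by
  constructor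
  · intro h
    generalize hw : u ++ [i] = w at h
    cases h with
    | root => simp at hw
    | child v hv =>
      obtain ⟨rfl, hij⟩ := List.append_inj' hw rfl
      exact ⟨hv, by simpa using hij⟩
  · rintro ⟨h, rfl⟩
    exact IsSpecial.child u h

theorem outDegree_eq {t : LFTree} {u : List ℕ} {k : ℕ}
    (h : ∀ i, u ++ [i] ∈ t.carrier ↔ i < k) : t.outDegree u = k := by
  have : {i : ℕ | u ++ [i] ∈ t.carrier} = (Finset.range k : Set ℕ) := by
    ext i; simp [h]
  rw [LFTree.outDegree, this, Set.ncard_coe_finset, Finset.card_range]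

theorem mem_iff_lt_outDegree {t : LFTree} {u : List ℕ} (hu : u ∈ t.carrier) (i : ℕ) :
    u ++ [i] ∈ t.carrier ↔ i < t.outDegree u := by
  obtain ⟨k, hk⟩ := t.exists_degree u hu
  rw [outDegree_eq hk, hk]

theorem outDegree_treeOf {κ : List ℕ → ℕ} {u : List ℕ} (hu : Grown κ u) :
    (treeOf κ).outDegree u = κ u :=
  outDegree_eq fun i => by
    change Grown κ (u ++ [i]) ↔ _
    simp [grown_append_singleton, hu]

theorem restr_finite (h : ℕ) (t : LFTree) : (LFTree.restr h t).Finite := by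
  induction h with
  | zero =>
    refine (Set.finite_singleton []).subset ?_
    rintro u ⟨_, hu⟩
    simpa using hu
  | succ h ih =>
    refine ((Set.finite_singleton []).union
      (ih.biUnion fun u _ => (Set.finite_Iio (t.outDegree u)).image fun i => u ++ [i])).subset ?_
    rintro u ⟨hu, hl⟩
    rcases List.eq_nil_or_concat u with rfl | ⟨v, i, rfl⟩
    · simp
    · right
      rw [List.concat_eq_append] at *
      have hv := t.ancestor_mem _ _ hu
      simp only [Set.mem_iUnion]
      exact ⟨v, ⟨hv, by simpa using hl⟩, i, (mem_iff_lt_outDegree hv i).1 hu, rfl⟩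

/-- A random tree grown from continuous numbers of children is continuous. -/
theorem continuous_treeOf {X : Type*} [TopologicalSpace X] (κ : X → List ℕ → ℕ)
    (hκ : ∀ u, Continuous fun x => κ x u) : Continuous fun x => treeOf (κ x) := by
  refine continuous_generateFrom_iff.2 ?_
  rintro _ ⟨h, t, rfl⟩
  rw [isOpen_iff_mem_nhds]
  intro x hx
  have hev : ∀ᶠ y in 𝓝 x, ∀ u ∈ LFTree.restr h (treeOf (κ x)), κ y u = κ x u := by
    rw [eventually_all_finite (restr_finite h _)]
    intro u _
    exact (hκ u).continuousAt.eventually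
      (IsOpen.mem_nhds (isOpen_discrete {κ x u}) rfl)
  filter_upwards [hev] with y hy
  have key : ∀ u : List ℕ, u.length ≤ h → (Grown (κ y) u ↔ Grown (κ x) u) := by
    intro u
    induction u using List.reverseRecOn with
    | nil => exact fun _ => ⟨fun _ => Grown.root, fun _ => Grown.root⟩
    | append_singleton u i ih =>
      intro hl
      have hl' : u.length ≤ h := by simp at hl; omega
      rw [grown_append_singleton, grown_append_singleton, ih hl']
      refine and_congr_right fun hu => ?_
      rw [hy u ⟨hu, hl'⟩]
  have hx' : LFTree.restr h (treeOf (κ x)) = LFTree.restr h t := hx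
  change LFTree.restr h (treeOf (κ y)) = LFTree.restr h t
  rw [← hx']
  ext u
  exact ⟨fun hu => ⟨(key u hu.2).1 hu.1, hu.2⟩, fun hu => ⟨(key u hu.2).2 hu.1, hu.2⟩⟩

theorem measurable_kestenTree : Measurable kestenTree := by
  have hsp : ∀ u, IsClopen {ω : Labels | IsSpecial ω u} := by
    intro u
    induction u using List.reverseRecOn with
    | nil =>
      convert isClopen_univ
      ext ω; simp [IsSpecial.root]
    | append_singleton u i ih =>
      have : {ω : Labels | IsSpecial ω (u ++ [i])}
          = {ω | IsSpecial ω u} ∩ (fun ω : Labels => (ω u).2.2) ⁻¹' {i} := by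
        ext ω; simp [isSpecial_append_singleton, eq_comm]
      rw [this]
      exact ih.inter ((isClopen_discrete {i}).preimage (by fun_prop))
  have : OpensMeasurableSpace Labels := Pi.opensMeasurableSpace
  refine (continuous_treeOf kestenDegree fun u => ?_).measurable
  classical
  unfold kestenDegree
  refine continuous_if (fun ω hω => ?_) (by fun_prop) (by fun_prop)
  rw [(hsp u).frontier_eq] at hω
  exact hω.elim

theorem subtree_treeOf {κ : List ℕ → ℕ} {i : ℕ} (hi : i < κ []) :
    (treeOf κ).subtree [i] = treeOf fun v => κ (i :: v) := by
  have key : ∀ v : List ℕ, Grown κ (i :: v) ↔ Grown (fun v => κ (i :: v)) v := by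
    intro v
    induction v using List.reverseRecOn with
    | nil =>
      have := grown_append_singleton κ [] i
      simp only [List.nil_append] at this
      simp [this, Grown.root, hi]
    | append_singleton v j ih =>
      rw [← List.cons_append, grown_append_singleton, grown_append_singleton, ih]
  ext v
  change (v = [] ∨ Grown κ (i :: v)) ↔ Grown (fun v => κ (i :: v)) v
  rw [key]
  refine ⟨?_, Or.inr⟩
  rintro (rfl | h)
  · exact Grown.root
  · exact h

/-- Galton-Watson trees exist: grow the tree from independent numbers of children. -/
theorem isGaltonWatson_treeOf (p : PMF ℕ) :
    IsGaltonWatson p (Measure.infinitePi fun _ : List ℕ => p.toMeasure) treeOf := by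
  set Q : Measure (List ℕ → ℕ) := Measure.infinitePi fun _ => p.toMeasure with hQ
  have hm : Measurable treeOf :=
    (continuous_treeOf (fun κ : List ℕ → ℕ => κ) fun u => continuous_apply u).measurable
  have hroot : ∀ κ : List ℕ → ℕ, (treeOf κ).outDegree [] = κ [] :=
    fun κ => outDegree_treeOf Grown.root
  have hr : ∀ n, Q {κ | κ [] = n} = p n := by
    intro n
    have h := (measurePreserving_eval_infinitePi (fun _ : List ℕ => p.toMeasure)
      []).measure_preimage (measurableSet_singleton n).nullMeasurableSet
    rw [PMF.toMeasure_apply_singleton _ _ (measurableSet_singleton n)] at h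
    exact h
  refine ⟨hm, fun n => by simpa only [hroot] using hr n, fun n A hA => ?_⟩
  simp only [hroot]
  have hset : {κ : List ℕ → ℕ | κ [] = n ∧ ∀ i : Fin n, (treeOf κ).subtree [(i : ℕ)] ∈ A i}
      = {κ | κ [] = n ∧ ∀ i : Fin n, treeOf (fun v => κ ((i : ℕ) :: v)) ∈ A i} := by
    ext κ
    refine and_congr_right fun h => forall_congr' fun i => ?_
    rw [subtree_treeOf (by omega)]
  rw [hset]
  let K : Option (Fin n) → Type := fun o => o.elim PUnit fun _ => List ℕ
  let f : (Σ o, K o) → List ℕ := fun s => match s with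
    | ⟨none, _⟩ => []
    | ⟨some i, v⟩ => (i : ℕ) :: v
  have hf : Function.Injective f := by
    rintro ⟨_ | i, v⟩ ⟨_ | j, w⟩ h
    · rfl
    · simp [f] at h
    · simp [f] at h
    · obtain ⟨h1, h2⟩ := List.cons.inj (show (i : ℕ) :: (v : List ℕ) = (j : ℕ) :: w from h)
      obtain rfl := Fin.ext h1
      cases h2
      rfl
  have hlaw := Measure.map_infinitePi_infinitePi_of_inj
    (P := fun _ : List ℕ => p.toMeasure) hf
  have hcur := Measure.infinitePi_map_piCurry
    (X := fun (o : Option (Fin n)) (_ : K o) => ℕ) (fun o (_ : K o) => p.toMeasure)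
  rw [← hlaw, Measure.map_map (by fun_prop) (by fun_prop)] at hcur
  let B : (o : Option (Fin n)) → Set (K o → ℕ) := fun o => match o with
    | none => {x | x PUnit.unit = n}
    | some i => {x | treeOf x ∈ A i}
  have hB : ∀ o, MeasurableSet (B o) := by
    rintro (_ | i)
    · exact measurable_pi_apply (X := fun _ : PUnit => ℕ) PUnit.unit (measurableSet_singleton n)
    · exact hm (hA i)
  have h := DFunLike.congr_fun hcur (Set.pi (Finset.univ : Finset (Option (Fin n))) B)
  rw [Measure.infinitePi_pi _ fun o _ => hB o,
    Measure.map_apply (by fun_prop) (MeasurableSet.pi (Set.to_countable _) fun o _ => hB o),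
    Fintype.prod_option] at h
  have e1 : (Measure.infinitePi fun _ : K none => p.toMeasure) (B none) = Q {κ | κ [] = n} := by
    rw [hr]
    have h := (measurePreserving_eval_infinitePi (fun _ : K none => p.toMeasure)
      PUnit.unit).measure_preimage (measurableSet_singleton n).nullMeasurableSet
    rw [PMF.toMeasure_apply_singleton _ _ (measurableSet_singleton n)] at h
    exact h
  rw [e1] at h
  refine Eq.trans ?_ h
  congr 1
  ext κ
  simp only [Set.mem_ofPred_eq, Set.mem_preimage, Set.mem_pi, Finset.coe_univ, Set.mem_univ,
    true_implies, Option.forall]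
  rfl

instance (p : PMF ℕ) (hp : IsCritical p) : IsProbabilityMeasure (labelLaw p hp) := by
  unfold labelLaw; infer_instance

/-- The law of Kesten's tree associated with a critical offspring distribution. -/
def kestenLaw (p : PMF ℕ) (hp : IsCritical p) : ProbabilityMeasure LFTree :=
  ⟨(labelLaw p hp).map kestenTree,
    Measure.isProbabilityMeasure_map measurable_kestenTree.aemeasurable⟩

/-- The conditional law of the random tree `τ` given an event of positive probability. -/
def condLaw {Ω : Type*} [MeasurableSpace Ω] (P : Measure Ω) [IsProbabilityMeasure P]
    (τ : Ω → LFTree) (hτ : Measurable τ) (E : Set Ω) (hE : P E ≠ 0) :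
    ProbabilityMeasure LFTree :=
  ⟨(P[|E]).map τ,
    haveI := cond_isProbabilityMeasure (μ := P) hE
    Measure.isProbabilityMeasure_map hτ.aemeasurable⟩

end GWTree

end

noncomputable section

namespace GWTree

namespace LFTree

/-! ### Decomposition of a tree at its root -/

/-! Write `F(b) = P(M ≤ b)`, and let `z` be the size of generation `h` of a fixed tree `t`. The
event `M ≤ b` bounds every out-degree separately. So once `b` exceeds the out-degrees of `t` below
height `h`, the event that `τ` agrees with `t` up to height `h` and `M ≤ b` only asks the `z`
independent sub-trees above generation `h` to satisfy `M ≤ b`. Its probability is `w * F(b)^z`, with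
`w` the probability of agreeing with `t` (`exists_measure_ball_inter`).

Conditioning on `a < M ≤ b` therefore gives agreement the probability `w * (F(b)^z - F(a)^z) / (F(b)
- F(a))`. The quotient is a sum of `z` products of powers of `F(a)` and `F(b)`, and it tends to `z`
because both tend to `1` (`tendsto_condLaw`). This limit holds because `M` is almost surely finite:
`P(M < ∞)` is a fixed point of the generating function, and criticality leaves only the fixed point
`1` (`eq_one_of_fixed_point`).

Kesten's tree agrees with `t` up to height `h` with probability exactly `w * z`, one term `w` for
each possible special vertex of generation `h` (`labelLaw_kestenTree_ball`). Balls determine weak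
convergence (`tendsto_of_tendsto_ball`). The two conditionings are the intervals `(n - 1, n]` and
`(n, ∞]`. -/

theorem mem_root_append (t : LFTree) (i : ℕ) : [i] ∈ t.carrier ↔ i < t.outDegree [] := by
  simpa using mem_iff_lt_outDegree t.nil_mem i

theorem cons_mem_iff (t : LFTree) (i : ℕ) (v : List ℕ) :
    i :: v ∈ t.carrier ↔ i < t.outDegree [] ∧ v ∈ (t.subtree [i]).carrier := by
  change _ ↔ _ ∧ (v = [] ∨ i :: v ∈ t.carrier)
  rw [← mem_root_append]
  constructor
  · exact fun h => ⟨t.ancestor_mem [i] v h, Or.inr h⟩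
  · rintro ⟨h, rfl | h'⟩
    exacts [h, h']

theorem outDegree_cons (t : LFTree) (i : ℕ) (hi : i < t.outDegree []) (v : List ℕ) :
    t.outDegree (i :: v) = (t.subtree [i]).outDegree v := by
  unfold outDegree
  congr 1
  ext j
  simp [cons_mem_iff, hi]

theorem restr_zero (t : LFTree) : restr 0 t = {[]} := by
  ext u
  simp only [restr, Nat.le_zero, List.length_eq_zero_iff, Set.mem_ofPred_eq,
    Set.mem_singleton_iff, and_iff_right_iff_imp]
  rintro rfl
  exact t.nil_mem

theorem mem_restr_iff_of_restr_eq {h : ℕ} {s t : LFTree} (e : restr h s = restr h t)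
    {u : List ℕ} (hu : u.length ≤ h) : u ∈ s.carrier ↔ u ∈ t.carrier := by
  have := Set.ext_iff.1 e u
  simpa [restr, hu] using this

theorem restr_eq_iff {h : ℕ} {s t : LFTree} :
    restr h s = restr h t ↔ ∀ u : List ℕ, u.length ≤ h → (u ∈ s.carrier ↔ u ∈ t.carrier) := by
  refine ⟨fun e u hu => mem_restr_iff_of_restr_eq e hu, fun H => ?_⟩
  ext u
  exact and_congr_left fun hu => H u hu

theorem restr_eq_of_le {h k : ℕ} (hk : h ≤ k) {s t : LFTree} (e : restr k s = restr k t) :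
    restr h s = restr h t :=
  restr_eq_iff.2 fun u hu => restr_eq_iff.1 e u (hu.trans hk)

theorem outDegree_eq_of_restr_eq {h : ℕ} {s t : LFTree} (e : restr h s = restr h t)
    {u : List ℕ} (hu : u.length < h) : s.outDegree u = t.outDegree u := by
  unfold outDegree
  congr 1
  ext i
  exact restr_eq_iff.1 e _ (by simpa using hu)

/-- This puts balls in the form required by the branching property, and drives the inductions on the
height. -/
theorem restr_succ_eq_iff {h : ℕ} {s t : LFTree} :
    restr (h + 1) s = restr (h + 1) t ↔ s.outDegree [] = t.outDegree [] ∧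
      ∀ i : Fin (t.outDegree []), restr h (s.subtree [(i : ℕ)]) = restr h (t.subtree [(i : ℕ)]) := by
  constructor
  · intro e
    have hd : s.outDegree [] = t.outDegree [] := outDegree_eq_of_restr_eq e (by simp)
    refine ⟨hd, fun i => restr_eq_iff.2 fun u hu => ?_⟩
    have := restr_eq_iff.1 e ((i : ℕ) :: u) (by simpa using hu)
    simpa [cons_mem_iff, hd] using this
  · rintro ⟨hd, H⟩
    refine restr_eq_iff.2 fun u hu => ?_
    cases u with
    | nil => simp [s.nil_mem, t.nil_mem]
    | cons i v =>
      rw [cons_mem_iff, cons_mem_iff, hd]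
      exact and_congr_right fun hi => restr_eq_iff.1 (H ⟨i, hi⟩) v (by simpa using hu)

/-! ### Recursive description of the maximal out-degree. -/

theorem maxOutDegree_le_iff_forall {t : LFTree} {b : ℕ∞} :
    t.maxOutDegree ≤ b ↔ ∀ u ∈ t.carrier, (t.outDegree u : ℕ∞) ≤ b := by
  simp [maxOutDegree]

theorem maxOutDegree_le_iff {t : LFTree} {b : ℕ∞} :
    t.maxOutDegree ≤ b ↔ (t.outDegree [] : ℕ∞) ≤ b ∧
      ∀ i : Fin (t.outDegree []), (t.subtree [(i : ℕ)]).maxOutDegree ≤ b := by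
  simp only [maxOutDegree_le_iff_forall]
  constructor
  · intro H
    refine ⟨H [] t.nil_mem, fun i u hu => ?_⟩
    rw [← outDegree_cons t i i.2]
    exact H _ ((cons_mem_iff t i u).2 ⟨i.2, hu⟩)
  · rintro ⟨h0, H⟩ u hu
    cases u with
    | nil => exact h0
    | cons i v =>
      obtain ⟨hi, hv⟩ := (cons_mem_iff t i v).1 hu
      rw [outDegree_cons t i hi]
      exact H ⟨i, hi⟩ v hv

/-! ### The local topology -/

/-- The set of trees that agree with `t` up to height `h`. -/
def ball (h : ℕ) (t : LFTree) : Set LFTree := {s | restr h s = restr h t}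

theorem isOpen_ball (h : ℕ) (t : LFTree) : IsOpen (ball h t) :=
  TopologicalSpace.isOpen_generateFrom_of_mem ⟨h, t, rfl⟩

theorem mem_ball_self (h : ℕ) (t : LFTree) : t ∈ ball h t := rfl

theorem ball_eq_of_mem {h : ℕ} {s t : LFTree} (hs : s ∈ ball h t) : ball h s = ball h t := by
  ext r
  change restr h r = restr h s ↔ restr h r = restr h t
  rw [show restr h s = restr h t from hs]

theorem ball_subset_ball {h k : ℕ} (hk : h ≤ k) (t : LFTree) : ball k t ⊆ ball h t :=
  fun _ hs => restr_eq_of_le hk hs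

theorem isOpen_of_forall_restr_eq {h : ℕ} {U : Set LFTree}
    (hU : ∀ s t, restr h s = restr h t → t ∈ U → s ∈ U) : IsOpen U :=
  isOpen_iff_forall_mem_open.2 fun t ht =>
    ⟨ball h t, fun s hs => hU s t hs ht, isOpen_ball h t, mem_ball_self h t⟩

theorem exists_ball_subset {U : Set LFTree} (hU : IsOpen U) {t : LFTree} (ht : t ∈ U) :
    ∃ h, ball h t ⊆ U := by
  induction hU with
  | basic V hV =>
    obtain ⟨h, s, rfl⟩ := hV
    exact ⟨h, (ball_eq_of_mem (show t ∈ ball h s from ht)).subset⟩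
  | univ => exact ⟨0, Set.subset_univ _⟩
  | inter V W _ _ hV hW =>
    obtain ⟨h, hh⟩ := hV ht.1
    obtain ⟨k, hk⟩ := hW ht.2
    exact ⟨max h k, Set.subset_inter ((ball_subset_ball (le_max_left _ _) t).trans hh)
      ((ball_subset_ball (le_max_right _ _) t).trans hk)⟩
  | sUnion S _ ih =>
    obtain ⟨V, hV, htV⟩ := ht
    obtain ⟨h, hh⟩ := ih V hV htV
    exact ⟨h, hh.trans (Set.subset_sUnion_of_mem hV)⟩

/-- The topology is ultrametric: of two balls that meet, one contains the other. -/
theorem isPiSystem_balls : IsPiSystem {B : Set LFTree | ∃ h t, B = ball h t} := by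
  rintro _ ⟨h, s, rfl⟩ _ ⟨k, t, rfl⟩ ⟨r, hr, hr'⟩
  refine ⟨max h k, r, ?_⟩
  rw [← ball_eq_of_mem hr, ← ball_eq_of_mem hr']
  rcases le_total h k with hk | hk
  · rw [max_eq_right hk, Set.inter_eq_right.2 (ball_subset_ball hk r)]
  · rw [max_eq_left hk, Set.inter_eq_left.2 (ball_subset_ball hk r)]

/-- A restriction is a finite set of words, so there are only countably many balls. -/
instance : SecondCountableTopology LFTree := by
  refine ⟨⟨{B | ∃ (h : ℕ) (t : LFTree), B = {s | restr h s = restr h t}}, ?_, rfl⟩⟩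
  refine (Set.countable_range fun x : ℕ × Finset (List ℕ) =>
    {s : LFTree | restr x.1 s = (x.2 : Set (List ℕ))}).mono ?_
  rintro _ ⟨h, t, rfl⟩
  exact ⟨(h, (restr_finite h t).toFinset), by simp⟩

theorem measurableSet_ball (h : ℕ) (t : LFTree) : MeasurableSet (ball h t) :=
  (isOpen_ball h t).measurableSet

theorem measurableSet_maxOutDegree_le (b : ℕ∞) :
    MeasurableSet {t : LFTree | t.maxOutDegree ≤ b} := by
  simp only [maxOutDegree_le_iff_forall]
  rw [show {t : LFTree | ∀ u ∈ t.carrier, (t.outDegree u : ℕ∞) ≤ b}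
    = ⋂ u : List ℕ, {t : LFTree | u ∈ t.carrier → (t.outDegree u : ℕ∞) ≤ b} by ext; simp]
  refine MeasurableSet.iInter fun u => IsOpen.measurableSet ?_
  -- The children of `u` lie one generation above `u`, whence the height `u.length + 1`.
  refine isOpen_of_forall_restr_eq (h := u.length + 1) fun s t e ht hu => ?_
  rw [outDegree_eq_of_restr_eq e (by simp)]
  exact ht ((restr_eq_iff.1 e u (by simp)).1 hu)

theorem measurableSet_maxOutDegree_mem_Ioc (a b : ℕ∞) :
    MeasurableSet {t : LFTree | a < t.maxOutDegree ∧ t.maxOutDegree ≤ b} := by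
  convert (measurableSet_maxOutDegree_le a).compl.inter (measurableSet_maxOutDegree_le b) using 1
  ext; simp

/-- Local convergence in distribution follows from the convergence of the probabilities of the
balls. -/
theorem tendsto_of_tendsto_ball {ι : Type*} {l : Filter ι} [l.IsCountablyGenerated]
    {μ : ι → ProbabilityMeasure LFTree} {ν : ProbabilityMeasure LFTree}
    (H : ∀ h t, Tendsto (fun i => (μ i : Measure LFTree) (ball h t)) l
      (𝓝 ((ν : Measure LFTree) (ball h t)))) : Tendsto μ l (𝓝 ν) := by
  refine isPiSystem_balls.tendsto_probabilityMeasure_of_tendsto_of_mem ?_ ?_ ?_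
  · rintro _ ⟨h, t, rfl⟩
    exact measurableSet_ball h t
  · intro U hU t ht
    obtain ⟨h, hh⟩ := exists_ball_subset hU ht
    exact ⟨_, ⟨h, t, rfl⟩, (isOpen_ball h t).mem_nhds (mem_ball_self h t), hh⟩
  · rintro _ ⟨h, t, rfl⟩
    exact (ENNReal.tendsto_toNNReal_iff (by simp) (by simp)).2 (H h t)

/-! ### Weights of truncated trees -/

/-- The size of the `h`-th generation of `t`. -/
def genSize : ℕ → LFTree → ℕ
  | 0, _ => 1
  | h + 1, t => ∑ i : Fin (t.outDegree []), genSize h (t.subtree [(i : ℕ)])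

/-- The probability that a Galton-Watson tree agrees with `t` up to height `h`. -/
def weight (p : PMF ℕ) : ℕ → LFTree → ℝ≥0∞
  | 0, _ => 1
  | h + 1, t => p (t.outDegree []) * ∏ i : Fin (t.outDegree []), weight p h (t.subtree [(i : ℕ)])

end LFTree

open LFTree

/-! ### Offspring distributions -/

/-- Multiplying Bernoulli's inequality for the exponent `k - 1` by `x` leaves the surplus `(k - 1) *
(1 - x) ^ 2`, which makes the inequality strict. -/
theorem one_sub_mul_lt_pow {x : ℝ} (h0 : 0 ≤ x) (h1 : x < 1) {k : ℕ} (hk : 2 ≤ k) :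
    1 - k * (1 - x) < x ^ k := by
  obtain ⟨m, rfl⟩ := Nat.exists_eq_add_of_le' hk
  have hb : 1 + ((m + 1 : ℕ) : ℝ) * (x - 1) ≤ x ^ (m + 1) :=
    one_add_mul_sub_le_pow (by linarith) _
  have hm := mul_le_mul_of_nonneg_left hb h0
  have hq : 0 < ((m : ℝ) + 1) * (1 - x) ^ 2 := by
    have : 0 < 1 - x := by linarith
    positivity
  rw [show x ^ (m + 2) = x * x ^ (m + 1) by ring]
  push_cast at hm ⊢
  nlinarith

/-- The generating function of a nondegenerate critical distribution has no fixed point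
in `[0, 1)`. -/
theorem eq_one_of_fixed_point {p : PMF ℕ} (hp : IsCritical p) {m : ℕ} (hm : 2 ≤ m)
    (hpm : 0 < p m) {s : ℝ≥0∞} (hs : s ≤ 1) (hfix : s = ∑' k, p k * s ^ k) : s = 1 := by
  have hs_ne : s ≠ ⊤ := ne_top_of_le_ne_top ENNReal.one_ne_top hs
  set x := s.toReal with hx
  have hx0 : 0 ≤ x := ENNReal.toReal_nonneg
  have hx1 : x ≤ 1 := by simpa using ENNReal.toReal_mono ENNReal.one_ne_top hs
  have key : ∀ (f : ℕ → ℝ≥0∞) (c : ℝ≥0∞), c ≠ ⊤ → ∑' k, f k = c →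
      HasSum (fun k => (f k).toReal) c.toReal := by
    intro f c hc e
    rw [← e] at hc ⊢
    rw [ENNReal.tsum_toReal_eq fun k => ENNReal.ne_top_of_tsum_ne_top hc k]
    exact ENNReal.hasSum_toReal hc
  have a1 := key _ 1 ENNReal.one_ne_top p.tsum_coe
  have a2 := key _ 1 ENNReal.one_ne_top hp
  have a3 := key _ s hs_ne hfix.symm
  -- Total mass, mean and fixed point combine into `∑ p_k * (x^k - 1 + k * (1 - x)) = 0`. Each term
  -- is nonnegative by Bernoulli, so the term `m` vanishes, against the strict inequality unless `x
  -- = 1`.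
  have a4 := (a3.sub a1).add (a2.mul_right (1 - x))
  simp only [ENNReal.toReal_one, ENNReal.toReal_mul, ENNReal.toReal_natCast,
    ENNReal.toReal_pow, ← hx] at a4
  rw [show x - 1 + 1 * (1 - x) = 0 by ring] at a4
  have hnn : ∀ k, 0 ≤ (p k).toReal * x ^ k - (p k).toReal + k * (p k).toReal * (1 - x) := by
    intro k
    have hb : 1 + (k : ℝ) * (x - 1) ≤ x ^ k := one_add_mul_sub_le_pow (by linarith) _
    have := mul_le_mul_of_nonneg_left hb (ENNReal.toReal_nonneg (a := p k))
    linarith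
  have hz := congrFun ((hasSum_zero_iff_of_nonneg hnn).1 a4) m
  simp only [Pi.zero_apply] at hz
  have hpm' : 0 < (p m).toReal := ENNReal.toReal_pos hpm.ne' (p.apply_ne_top m)
  have hx' : x = 1 := by
    by_contra hne
    have hlt := mul_lt_mul_of_pos_left
      (one_sub_mul_lt_pow hx0 (lt_of_le_of_ne hx1 hne) hm) hpm'
    linarith
  rw [← ENNReal.ofReal_toReal hs_ne, ← hx, hx', ENNReal.ofReal_one]

theorem IsUnbounded.exists_gt {p : PMF ℕ} (hp : IsUnbounded p) (n : ℕ) : ∃ m, n < m ∧ 0 < p m := by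
  by_contra! H
  exact hp ⟨n, fun m hm => not_lt.1 fun h => absurd hm (not_lt.2 (H m h))⟩

/-- If `p 0` vanished, `0` would be a fixed point of the generating function. -/
theorem IsCritical.apply_zero_pos {p : PMF ℕ} (hp : IsCritical p) (hu : IsUnbounded p) :
    0 < p 0 := by
  obtain ⟨m, hm, hpm⟩ := hu.exists_gt 1
  rw [pos_iff_ne_zero]
  intro h0
  refine zero_ne_one (eq_one_of_fixed_point hp hm hpm zero_le_one ?_)
  refine (ENNReal.tsum_eq_zero.2 fun k => ?_).symm
  rcases Nat.eq_zero_or_pos k with rfl | hk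
  · simp [h0]
  · simp [hk.ne']

/-! ### Galton-Watson trees -/

namespace IsGaltonWatson

variable {Ω : Type*} [MeasurableSpace Ω] {p : PMF ℕ} {P : Measure Ω} {τ : Ω → LFTree}

/-- The branching property for a property of trees that is inherited by the sub-trees. -/
theorem measure_eq_tsum (hτ : IsGaltonWatson p P τ) {A : Set LFTree} (hA : MeasurableSet A)
    (D : Set ℕ) (hAD : ∀ t, t ∈ A ↔
      t.outDegree [] ∈ D ∧ ∀ i : Fin (t.outDegree []), t.subtree [(i : ℕ)] ∈ A) :
    P {ω | τ ω ∈ A} = ∑' k, D.indicator p k * P {ω | τ ω ∈ A} ^ k := by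
  have hdeg : ∀ k, MeasurableSet {ω | (τ ω).outDegree [] = k} := fun k =>
    hτ.measurable <| IsOpen.measurableSet (s := {t : LFTree | t.outDegree [] = k}) <|
      isOpen_of_forall_restr_eq (h := 1) fun s t e ht =>
        (outDegree_eq_of_restr_eq e (by simp)).trans ht
  have hsum : P {ω | τ ω ∈ A} = ∑' k, P ({ω | τ ω ∈ A} ∩ {ω | (τ ω).outDegree [] = k}) := by
    rw [← measure_iUnion _ fun k =>
      (show MeasurableSet {ω | τ ω ∈ A} from hτ.measurable hA).inter (hdeg k)]
    · congr 1; ext; simp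
    · intro j k hjk
      refine Set.disjoint_left.2 ?_
      rintro ω ⟨_, h⟩ ⟨_, h'⟩
      exact hjk (h.symm.trans h')
  conv_lhs => rw [hsum]
  refine tsum_congr fun k => ?_
  by_cases hk : k ∈ D
  · rw [Set.indicator_of_mem hk, ← hτ.root k]
    have := hτ.branching k (fun _ => A) fun _ => hA
    simp only [Finset.prod_const, Finset.card_univ, Fintype.card_fin] at this
    rw [← this]
    congr 1
    ext ω
    simp only [Set.mem_inter_iff, Set.mem_ofPred_eq]
    rw [and_comm]
    refine and_congr_right fun h => ?_
    subst h
    rw [hAD]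
    exact and_iff_right hk
  · rw [Set.indicator_of_notMem hk, zero_mul]
    convert measure_empty (μ := P)
    ext ω
    simp only [Set.mem_inter_iff, Set.mem_ofPred_eq, Set.mem_empty_iff_false, iff_false]
    rintro ⟨h, rfl⟩
    exact hk ((hAD _).1 h).1

/-! ### Law of the maximal out-degree. -/

theorem measure_maxOutDegree_le (hτ : IsGaltonWatson p P τ) (b : ℕ∞) :
    P {ω | (τ ω).maxOutDegree ≤ b} =
      ∑' k, {k : ℕ | (k : ℕ∞) ≤ b}.indicator p k * P {ω | (τ ω).maxOutDegree ≤ b} ^ k :=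
  hτ.measure_eq_tsum (measurableSet_maxOutDegree_le b) _ fun _ => maxOutDegree_le_iff

/-- The maximal out-degree of a critical Galton-Watson tree is finite. -/
theorem measure_maxOutDegree_lt_top [IsProbabilityMeasure P] (hτ : IsGaltonWatson p P τ)
    (hp : IsCritical p) (hu : IsUnbounded p) : P {ω | (τ ω).maxOutDegree < ⊤} = 1 := by
  obtain ⟨m, hm, hpm⟩ := hu.exists_gt 1
  refine eq_one_of_fixed_point hp hm hpm prob_le_one ?_
  have hex : ∀ t : LFTree, t.maxOutDegree < ⊤ ↔ ∃ n : ℕ, t.maxOutDegree ≤ n := fun t =>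
    ⟨fun h => ⟨_, (ENat.natCast_toNat h.ne).ge⟩, fun ⟨n, hn⟩ => hn.trans_lt (ENat.natCast_lt_top n)⟩
  have hmeas : MeasurableSet {t : LFTree | t.maxOutDegree < ⊤} := by
    simp only [hex]
    rw [show {t : LFTree | ∃ n : ℕ, t.maxOutDegree ≤ n}
      = ⋃ n : ℕ, {t : LFTree | t.maxOutDegree ≤ n} by ext; simp]
    exact MeasurableSet.iUnion fun n => measurableSet_maxOutDegree_le n
  -- Finiteness of the maximal out-degree puts no constraint on the root, so with `D = univ` the
  -- recursion is the fixed point equation itself.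
  have h := hτ.measure_eq_tsum hmeas Set.univ fun t => by
    simp only [Set.mem_univ, true_and, Set.mem_ofPred_eq]
    constructor
    · intro ht i
      exact ((maxOutDegree_le_iff.1 le_rfl).2 i).trans_lt ht
    · intro H
      refine lt_of_le_of_lt (maxOutDegree_le_iff.2 ⟨le_max_left _ (Finset.univ.sup
        fun i : Fin (t.outDegree []) => (t.subtree [(i : ℕ)]).maxOutDegree), fun i =>
          le_max_of_le_right (Finset.le_sup (f := fun i : Fin (t.outDegree []) =>
            (t.subtree [(i : ℕ)]).maxOutDegree) (Finset.mem_univ i))⟩) ?_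
      exact max_lt (ENat.natCast_lt_top _) ((Finset.sup_lt_iff (by simp)).2 fun i _ => H i)
  simpa using h

theorem tendsto_measure_maxOutDegree_le [IsProbabilityMeasure P] (hτ : IsGaltonWatson p P τ)
    (hp : IsCritical p) (hu : IsUnbounded p) :
    Tendsto (fun n : ℕ => P {ω | (τ ω).maxOutDegree ≤ n}) atTop (𝓝 1) := by
  rw [← hτ.measure_maxOutDegree_lt_top hp hu]
  have : {ω | (τ ω).maxOutDegree < ⊤} = ⋃ n : ℕ, {ω | (τ ω).maxOutDegree ≤ n} := by
    ext ω
    simp only [Set.mem_ofPred_eq, Set.mem_iUnion]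
    exact ⟨fun h => ⟨_, (ENat.natCast_toNat h.ne).ge⟩,
      fun ⟨n, hn⟩ => hn.trans_lt (ENat.natCast_lt_top n)⟩
  rw [this]
  exact tendsto_measure_iUnion_atTop fun m n hmn ω h =>
    (show (τ ω).maxOutDegree ≤ m from h).trans (Nat.cast_le.2 hmn)

/-- If the event were null, `F(n - 1)` and `F(n)` would coincide; comparing their recursions, whose
sums differ by the single term `p n * F(n)^n`, forces that term to vanish. -/
theorem measure_maxOutDegree_eq_pos [IsProbabilityMeasure P] (hτ : IsGaltonWatson p P τ)
    (hp : IsCritical p) (hu : IsUnbounded p) {n : ℕ} (hn : 0 < p n) :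
    P {ω | (τ ω).maxOutDegree = n} ≠ 0 := by
  intro hz
  set F := P {ω | (τ ω).maxOutDegree ≤ n} with hF
  have hF0 : F ≠ 0 := by
    rw [hF, hτ.measure_maxOutDegree_le]
    intro h
    have := ENNReal.tsum_eq_zero.1 h 0
    simp [(hp.apply_zero_pos hu).ne'] at this
  have hFtop : F ≠ ⊤ := measure_ne_top _ _
  -- At `n = 0` there is no lower level to compare with, but `M ≤ 0` is then the event itself.
  rcases Nat.eq_zero_or_pos n with rfl | hn0
  · apply hF0
    rw [hF, ← hz]
    congr 1
    ext; simp
  obtain ⟨k, rfl⟩ := Nat.exists_eq_add_of_le' hn0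
  have hk : P {ω | (τ ω).maxOutDegree ≤ k} = F := by
    refine le_antisymm (measure_mono fun ω h =>
      (show (τ ω).maxOutDegree ≤ k from h).trans (Nat.cast_le.2 k.le_succ)) ?_
    calc F ≤ P ({ω | (τ ω).maxOutDegree ≤ k} ∪ {ω | (τ ω).maxOutDegree = (k + 1 : ℕ)}) := by
          refine measure_mono fun ω h => ?_
          rcases (show (τ ω).maxOutDegree ≤ (k + 1 : ℕ) from h).eq_or_lt with h | h
          · exact Or.inr h
          · exact Or.inl (ENat.lt_natCast_add_one_iff.1 (by exact_mod_cast h))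
      _ ≤ _ := measure_union_le _ _
      _ = _ := by rw [hz, add_zero]
  have e1 := hτ.measure_maxOutDegree_le k
  have e2 := hτ.measure_maxOutDegree_le (k + 1 : ℕ)
  rw [hk] at e1
  rw [← hF] at e2
  have hsplit : (∑' j, {j : ℕ | (j : ℕ∞) ≤ (k + 1 : ℕ)}.indicator p j * F ^ j)
      = (∑' j, {j : ℕ | (j : ℕ∞) ≤ k}.indicator p j * F ^ j) + p (k + 1) * F ^ (k + 1) := by
    rw [← tsum_ite_eq (k + 1) (fun j => p j * F ^ j), ← ENNReal.tsum_add]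
    refine tsum_congr fun j => ?_
    simp only [Set.indicator_apply, Set.mem_ofPred_eq, Nat.cast_le]
    rcases lt_trichotomy j (k + 1) with h | rfl | h
    · simp [h.ne, h.le, Nat.lt_succ_iff.1 h]
    · simp
    · simp [h.ne', h.not_ge, (Nat.lt_of_succ_lt h).not_ge]
  rw [hsplit, ← e1] at e2
  have : p (k + 1) * F ^ (k + 1) = 0 := by
    rw [← ENNReal.add_right_inj hFtop, add_zero, ← e2]
  rcases mul_eq_zero.1 this with h | h
  · exact hn.ne' h
  · exact hF0 (pow_eq_zero_iff (by simp) |>.1 h)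

/-- The joint law of the first `h` generations and of the maximal out-degree, away from the
out-degrees of the first generations. -/
theorem exists_measure_ball_inter [IsProbabilityMeasure P] (hτ : IsGaltonWatson p P τ) (h : ℕ)
    (t : LFTree) : ∃ N : ℕ, ∀ b : ℕ∞, N ≤ b →
      P {ω | τ ω ∈ ball h t ∧ (τ ω).maxOutDegree ≤ b}
        = weight p h t * P {ω | (τ ω).maxOutDegree ≤ b} ^ genSize h t := by
  induction h generalizing t with
  | zero => exact ⟨0, fun b _ => by simp [ball, restr_zero, weight, genSize]⟩
  | succ h ih =>
    choose N hN using fun i : Fin (t.outDegree []) => ih (t.subtree [(i : ℕ)])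
    -- The bound makes the constraint on the root automatic and keeps `b` admissible for every
    -- sub-tree of `t` above a child of the root.
    refine ⟨max (t.outDegree []) (Finset.univ.sup N), fun b hb => ?_⟩
    have hdeg : (t.outDegree [] : ℕ∞) ≤ b := le_trans (by exact_mod_cast le_max_left _ _) hb
    have hNb : ∀ i, (N i : ℕ∞) ≤ b := fun i => le_trans
      (by exact_mod_cast le_max_of_le_right (Finset.le_sup (Finset.mem_univ i))) hb
    have hbr := hτ.branching (t.outDegree [])
      (fun i => ball h (t.subtree [(i : ℕ)]) ∩ {s | s.maxOutDegree ≤ b})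
      fun i => (measurableSet_ball _ _).inter (measurableSet_maxOutDegree_le b)
    have hset : {ω | τ ω ∈ ball (h + 1) t ∧ (τ ω).maxOutDegree ≤ b}
        = {ω | (τ ω).outDegree [] = t.outDegree [] ∧ ∀ i : Fin (t.outDegree []),
          (τ ω).subtree [(i : ℕ)] ∈ ball h (t.subtree [(i : ℕ)]) ∩ {s | s.maxOutDegree ≤ b}} := by
      ext ω
      change restr (h + 1) (τ ω) = restr (h + 1) t ∧ _ ↔ _ ∧ ∀ i, _ = _ ∧ _ ≤ b
      rw [restr_succ_eq_iff, and_assoc, maxOutDegree_le_iff, forall_and]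
      refine and_congr_right fun hd => and_congr_right fun _ => ?_
      rw [hd]
      exact and_iff_right hdeg
    rw [hset, hbr, hτ.root, weight, genSize, mul_assoc, ← Finset.prod_pow_eq_pow_sum,
      ← Finset.prod_mul_distrib]
    congr 1
    exact Finset.prod_congr rfl fun i _ => hN i b (hNb i)

/-- At `b = ⊤` the constraint on the maximal out-degree is vacuous. -/
theorem measure_ball [IsProbabilityMeasure P] (hτ : IsGaltonWatson p P τ) (h : ℕ) (t : LFTree) :
    P {ω | τ ω ∈ ball h t} = weight p h t := by
  obtain ⟨N, hN⟩ := hτ.exists_measure_ball_inter h t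
  simpa using hN ⊤ le_top

/-- Conditionally on the event that the maximal out-degree belongs to a remote interval, the
probability of a ball is asymptotically biased by the size of the last generation. -/
theorem tendsto_condLaw [IsProbabilityMeasure P] (hτ : IsGaltonWatson p P τ)
    (hp : IsCritical p) (hu : IsUnbounded p) {ι : Type*} {l : Filter ι} {E : ι → Set Ω}
    (hE : ∀ i, P (E i) ≠ 0) {a : ι → ℕ} {b : ι → ℕ∞} (ha : Tendsto a l atTop)
    (hab : ∀ i, a i ≤ b i)
    (hEab : ∀ᶠ i in l, E i = {ω | (a i : ℕ∞) < (τ ω).maxOutDegree ∧ (τ ω).maxOutDegree ≤ b i})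
    (h : ℕ) (t : LFTree) :
    Tendsto (fun i => (condLaw P τ hτ.measurable (E i) (hE i) : Measure LFTree) (ball h t)) l
      (𝓝 (weight p h t * genSize h t)) := by
  set F : ℕ∞ → ℝ≥0∞ := fun b => P {ω | (τ ω).maxOutDegree ≤ b} with hF
  have hFtop : ∀ b, F b ≠ ⊤ := fun b => measure_ne_top _ _
  have hmono : Monotone F := fun b c hbc => measure_mono fun ω hω => le_trans hω hbc
  have hFa : Tendsto (fun i => F (a i)) l (𝓝 1) :=
    (hτ.tendsto_measure_maxOutDegree_le hp hu).comp ha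
  have hFb : Tendsto (fun i => F (b i)) l (𝓝 1) :=
    tendsto_of_tendsto_of_tendsto_of_le_of_le hFa tendsto_const_nhds
      (fun i => hmono (hab i)) fun i => prob_le_one
  obtain ⟨N, hN⟩ := hτ.exists_measure_ball_inter h t
  set z := genSize h t with hz
  -- The difference quotient is handled as a sum of `z` terms, each tending to `1`, since its
  -- denominator tends to `0`.
  have hlim : Tendsto (fun i => weight p h t *
      ∑ j ∈ Finset.range z, F (b i) ^ j * F (a i) ^ (z - 1 - j)) l
      (𝓝 (weight p h t * z)) := by
    have hw : weight p h t ≠ ⊤ := by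
      rw [← hτ.measure_ball]; exact measure_ne_top _ _
    refine ENNReal.Tendsto.const_mul ?_ (Or.inr hw)
    have : (z : ℝ≥0∞) = ∑ j ∈ Finset.range z, 1 ^ j * 1 ^ (z - 1 - j) := by simp
    rw [this]
    refine tendsto_finsetSum _ fun j _ => ?_
    exact ENNReal.Tendsto.mul (((ENNReal.continuous_pow j).tendsto 1).comp hFb) (by simp)
      (((ENNReal.continuous_pow _).tendsto 1).comp hFa) (by simp)
  refine hlim.congr' ?_
  filter_upwards [hEab, ha.eventually_ge_atTop N] with i hi hNi
  have hdiff : ∀ B : Set LFTree, MeasurableSet B →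
      P {ω | τ ω ∈ B ∧ (a i : ℕ∞) < (τ ω).maxOutDegree ∧ (τ ω).maxOutDegree ≤ b i}
        = P {ω | τ ω ∈ B ∧ (τ ω).maxOutDegree ≤ b i}
          - P {ω | τ ω ∈ B ∧ (τ ω).maxOutDegree ≤ a i} := by
    intro B hB
    rw [← measure_sdiff (show {ω | τ ω ∈ B ∧ (τ ω).maxOutDegree ≤ a i}
        ⊆ {ω | τ ω ∈ B ∧ (τ ω).maxOutDegree ≤ b i} from fun ω hω => ⟨hω.1, hω.2.trans (hab i)⟩)
      (hτ.measurable (hB.inter (measurableSet_maxOutDegree_le _))).nullMeasurableSet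
      (measure_ne_top _ _)]
    congr 1
    ext ω
    simp only [Set.mem_ofPred_eq, Set.mem_sdiff, not_and, not_le]
    tauto
  have hPE : P (E i) = F (b i) - F (a i) := by
    have := hdiff Set.univ MeasurableSet.univ
    simp only [Set.mem_univ, true_and] at this
    rw [hi, this]
  have hmE : MeasurableSet (E i) := by
    rw [hi]; exact hτ.measurable (measurableSet_maxOutDegree_mem_Ioc _ _)
  have hcond : (condLaw P τ hτ.measurable (E i) (hE i) : Measure LFTree) (ball h t)
      = (P (E i))⁻¹ * P (E i ∩ {ω | τ ω ∈ ball h t}) := by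
    change (P[|E i]).map τ (ball h t) = _
    rw [Measure.map_apply hτ.measurable (measurableSet_ball h t), cond_apply hmE]
    rfl
  have hball : P (E i ∩ {ω | τ ω ∈ ball h t})
      = (weight p h t * ∑ j ∈ Finset.range z, F (b i) ^ j * F (a i) ^ (z - 1 - j)) * P (E i) := by
    have hw : weight p h t ≠ ⊤ := by
      rw [← hτ.measure_ball]; exact measure_ne_top _ _
    have h1 := hdiff (ball h t) (measurableSet_ball h t)
    rw [hN _ (le_trans (by exact_mod_cast hNi) (hab i)), hN (a i) (by exact_mod_cast hNi)] at h1
    rw [Set.inter_comm, hi]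
    refine h1.trans ?_
    rw [← hi, hPE, ← ENNReal.mul_sub (fun _ _ => hw), mul_assoc]
    congr 1
    -- The factorisation of `F(b)^z - F(a)^z` is carried out in `NNReal`, with truncated
    -- subtraction; `F(a) ≤ F(b)` makes it exact.
    have hg := geom_sum₂_mul_of_ge (R := NNReal)
      (ENNReal.toNNReal_mono (hFtop (b i)) (hmono (hab i))) z
    have hg' := congrArg ((↑) : NNReal → ℝ≥0∞) hg
    push_cast at hg'
    simp only [ENNReal.coe_toNNReal (hFtop _)] at hg'
    exact hg'.symm
  rw [hcond, hball, mul_comm (P (E i))⁻¹, mul_assoc _ (P (E i)), ENNReal.mul_inv_cancel (hE i)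
    (measure_ne_top _ _),
    mul_one]

end IsGaltonWatson

/-! ### Kesten's tree -/

/-- The label of the root and the labels above its distinct children are independent. -/
theorem infinitePi_root_children {X : Type*} [MeasurableSpace X] (μ : Measure X)
    [IsProbabilityMeasure μ] (n : ℕ) {B : Set X} (hB : MeasurableSet B)
    {C : Fin n → Set (List ℕ → X)} (hC : ∀ i, MeasurableSet (C i)) :
    (Measure.infinitePi fun _ : List ℕ => μ)
        {ω | ω [] ∈ B ∧ ∀ i : Fin n, (fun v => ω ((i : ℕ) :: v)) ∈ C i}
      = μ B * ∏ i, (Measure.infinitePi fun _ : List ℕ => μ) (C i) := by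
  let K : Option (Fin n) → Type := fun o => o.elim PUnit fun _ => List ℕ
  -- The root and the words above each of the `n` children form disjoint blocks of coordinates; `f`
  -- embeds them, and currying turns the product law into a product over blocks.
  let f : (Σ o, K o) → List ℕ := fun s => match s with
    | ⟨none, _⟩ => []
    | ⟨some i, v⟩ => (i : ℕ) :: v
  have hf : Function.Injective f := by
    rintro ⟨_ | i, v⟩ ⟨_ | j, w⟩ h
    · rfl
    · simp [f] at h
    · simp [f] at h
    · obtain ⟨h1, h2⟩ := List.cons.inj (show (i : ℕ) :: (v : List ℕ) = (j : ℕ) :: w from h)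
      obtain rfl := Fin.ext h1
      cases h2
      rfl
  have hlaw := Measure.map_infinitePi_infinitePi_of_inj (P := fun _ : List ℕ => μ) hf
  have hcur := Measure.infinitePi_map_piCurry
    (X := fun (o : Option (Fin n)) (_ : K o) => X) (fun o (_ : K o) => μ)
  rw [← hlaw, Measure.map_map (by fun_prop) (by fun_prop)] at hcur
  let D : (o : Option (Fin n)) → Set (K o → X) := fun o => match o with
    | none => {x | x PUnit.unit ∈ B}
    | some i => C i
  have hD : ∀ o, MeasurableSet (D o) := by
    rintro (_ | i)
    · exact measurable_pi_apply (X := fun _ : PUnit => X) PUnit.unit hB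
    · exact hC i
  have h := DFunLike.congr_fun hcur (Set.pi (Finset.univ : Finset (Option (Fin n))) D)
  rw [Measure.infinitePi_pi _ fun o _ => hD o,
    Measure.map_apply (by fun_prop) (MeasurableSet.pi (Set.to_countable _) fun o _ => hD o),
    Fintype.prod_option] at h
  have e1 : (Measure.infinitePi fun _ : K none => μ) (D none) = μ B :=
    (measurePreserving_eval_infinitePi (fun _ : K none => μ)
      PUnit.unit).measure_preimage hB.nullMeasurableSet
  rw [e1] at h
  refine Eq.trans ?_ h
  congr 1
  ext ω
  simp only [Set.mem_ofPred_eq, Set.mem_preimage, Set.mem_pi, Finset.coe_univ, Set.mem_univ,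
    true_implies, Option.forall]
  rfl

/-- The spine is defined by appending letters at the end of words, whereas the decomposition at the
root removes the first letter. -/
theorem isSpecial_cons (ω : Labels) (i : ℕ) (v : List ℕ) :
    IsSpecial ω (i :: v) ↔ i = (ω []).2.2 ∧ IsSpecial (fun w => ω (i :: w)) v := by
  induction v using List.reverseRecOn with
  | nil =>
    have := isSpecial_append_singleton ω [] i
    simp only [List.nil_append] at this
    simp [this, IsSpecial.root]
  | append_singleton v j ih =>
    rw [← List.cons_append, isSpecial_append_singleton, isSpecial_append_singleton, ih, and_assoc]

/-- The tree in which all the vertices are normal. -/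
def normalTree (ω : Labels) : LFTree := treeOf fun u => (ω u).1

theorem outDegree_kestenTree_root (ω : Labels) : (kestenTree ω).outDegree [] = (ω []).2.1 := by
  rw [kestenTree, outDegree_treeOf Grown.root, kestenDegree, if_pos IsSpecial.root]

theorem subtree_kestenTree (ω : Labels) {i : ℕ} (hi : i < (ω []).2.1) :
    (kestenTree ω).subtree [i] = if i = (ω []).2.2 then kestenTree (fun w => ω (i :: w))
      else normalTree (fun w => ω (i :: w)) := by
  rw [kestenTree, subtree_treeOf (by rwa [kestenDegree, if_pos IsSpecial.root])]
  split_ifs with h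
  · congr 1
    ext v
    have hv : IsSpecial ω (i :: v) ↔ IsSpecial (fun w => ω (i :: w)) v :=
      (isSpecial_cons ω i v).trans (and_iff_right h)
    unfold kestenDegree
    split_ifs <;> tauto
  · unfold normalTree
    congr 1
    ext v
    simp [kestenDegree, isSpecial_cons, h]

theorem uniformChild_apply {k : ℕ} (hk : k ≠ 0) (j : ℕ) :
    uniformChild k j = if j < k then (k : ℝ≥0∞)⁻¹ else 0 := by
  obtain ⟨k, rfl⟩ := Nat.exists_eq_succ_of_ne_zero hk
  refine (PMF.uniformOfFinset_apply (Finset.nonempty_range_add_one) j).trans ?_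
  simp

/-- The size-biasing factor `k` cancels the uniform weight `1 / k`, so every admissible position of
the special child carries the same mass `p k`. -/
theorem specialOffspring_apply (p : PMF ℕ) (hp : IsCritical p) (k j : ℕ) :
    specialOffspring p hp (k, j) = if j < k then p k else 0 := by
  have hmap : ∀ m, ((uniformChild m).map fun i => (m, i)) (k, j)
      = if m = k then uniformChild k j else 0 := by
    intro m
    rw [PMF.map_apply]
    split_ifs with h
    · subst h
      simp
    · simp [Ne.symm h]
  rw [specialOffspring, PMF.bind_apply]
  simp only [hmap, mul_ite, mul_zero]
  rw [tsum_ite_eq k (fun m => sizeBiased p hp m * uniformChild k j)]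
  change (k : ℝ≥0∞) * p k * uniformChild k j = _
  rcases eq_or_ne k 0 with rfl | hk
  · simp
  rw [uniformChild_apply hk]
  split_ifs
  · rw [mul_right_comm, ENNReal.mul_inv_cancel (by simpa using hk) (by simp), one_mul]
  · simp

theorem measurable_normalTree : Measurable normalTree := by
  have : OpensMeasurableSpace Labels := Pi.opensMeasurableSpace
  exact (continuous_treeOf (fun (ω : Labels) u => (ω u).1) fun u => by fun_prop).measurable

/-- The first components of the labels are independent with law `p`, so the normal tree is a
Galton-Watson tree. -/
theorem labelLaw_normalTree_ball (p : PMF ℕ) (hp : IsCritical p) (h : ℕ) (t : LFTree) :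
    labelLaw p hp {ω | normalTree ω ∈ ball h t} = weight p h t := by
  have hmap := Measure.infinitePi_map_pi
    (fun _ : List ℕ => p.toMeasure.prod (specialOffspring p hp).toMeasure)
    (f := fun _ => Prod.fst) fun _ => measurable_fst
  simp only [Measure.map_fst_prod, measure_univ, one_smul] at hmap
  have hgw := isGaltonWatson_treeOf p
  rw [← hgw.measure_ball, ← hmap, Measure.map_apply (by fun_prop)
    (show MeasurableSet {κ | treeOf κ ∈ ball h t} from
      hgw.measurable (measurableSet_ball h t))]
  rfl

/-- The law of the first generations of Kesten's tree is the one of the Galton-Watson tree biased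
by the size of the last generation. -/
theorem labelLaw_kestenTree_ball (p : PMF ℕ) (hp : IsCritical p) (h : ℕ) (t : LFTree) :
    labelLaw p hp {ω | kestenTree ω ∈ ball h t} = weight p h t * genSize h t := by
  induction h generalizing t with
  | zero => simp [ball, restr_zero, weight, genSize]
  | succ h ih =>
    set k := t.outDegree [] with hk
    let C : ℕ → Fin k → Set Labels := fun j i =>
      if (i : ℕ) = j then {ω | kestenTree ω ∈ ball h (t.subtree [(i : ℕ)])}
      else {ω | normalTree ω ∈ ball h (t.subtree [(i : ℕ)])}
    have hC : ∀ j i, MeasurableSet (C j i) := by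
      intro j i
      by_cases hij : (i : ℕ) = j
      · simp only [C, if_pos hij]
        exact measurable_kestenTree (measurableSet_ball _ _)
      · simp only [C, if_neg hij]
        exact measurable_normalTree (measurableSet_ball _ _)
    let S : ℕ → Set Labels := fun j => {ω | ω [] ∈ Set.univ ×ˢ {(k, j)} ∧
      ∀ i : Fin k, (fun v => ω ((i : ℕ) :: v)) ∈ C j i}
    -- The event is split according to the index `j` of the special child of the root; on each piece
    -- the sub-tree `j` is a Kesten tree and the others are normal.
    have hset : {ω | kestenTree ω ∈ ball (h + 1) t} = ⋃ j, S j := by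
      ext ω
      change restr (h + 1) (kestenTree ω) = restr (h + 1) t ↔ _
      rw [restr_succ_eq_iff, outDegree_kestenTree_root]
      have : ∀ j, ω ∈ S j ↔ (ω []).2.2 = j ∧ (ω []).2.1 = k ∧
          ∀ i : Fin k, (fun v => ω ((i : ℕ) :: v)) ∈ C j i := by
        intro j
        simp only [S, Set.mem_ofPred_eq, Set.mem_prod, Set.mem_univ, true_and,
          Set.mem_singleton_iff, Prod.ext_iff]
        tauto
      simp only [Set.mem_iUnion, this, exists_eq_left']
      refine and_congr_right fun hd => forall_congr' fun i => ?_
      rw [subtree_kestenTree ω (by rw [hd]; exact i.2)]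
      by_cases hi : (i : ℕ) = (ω []).2.2
      · simp only [C, if_pos hi]; rfl
      · simp only [C, if_neg hi]; rfl
    have hS : ∀ j, MeasurableSet (S j) := fun j => by
      refine MeasurableSet.inter (s₂ := {ω : Labels | ∀ i : Fin k,
        (fun v => ω ((i : ℕ) :: v)) ∈ C j i}) ?_ ?_
      · exact measurable_pi_apply (X := fun _ : List ℕ => ℕ × ℕ × ℕ) [] (MeasurableSet.univ.prod
          (measurableSet_singleton _))
      · rw [Set.ofPred_forall]
        exact MeasurableSet.iInter fun i => (show Measurable fun (ω : Labels) (v : List ℕ) =>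
          ω ((i : ℕ) :: v) by fun_prop) (hC j i)
    have hdisj : Pairwise (Function.onFun Disjoint S) := by
      intro j j' hjj
      refine Set.disjoint_left.2 fun ω hω hω' => hjj ?_
      have e1 : (ω []).2 = (k, j) := hω.1.2
      have e2 : (ω []).2 = (k, j') := hω'.1.2
      exact (Prod.ext_iff.1 (e1.symm.trans e2)).2
    have hmS : ∀ j, labelLaw p hp (S j) = (if j < k then p k else 0) *
        ∏ i : Fin k, weight p h (t.subtree [(i : ℕ)]) *
          if (i : ℕ) = j then (genSize h (t.subtree [(i : ℕ)]) : ℝ≥0∞) else 1 := by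
      intro j
      refine (infinitePi_root_children _ k (MeasurableSet.univ.prod
        (measurableSet_singleton _)) (hC j)).trans ?_
      rw [Measure.prod_prod, measure_univ, one_mul,
        PMF.toMeasure_apply_singleton _ _ (measurableSet_singleton _), specialOffspring_apply]
      congr 1
      refine Finset.prod_congr rfl fun i _ => ?_
      change labelLaw p hp (C j i) = _
      by_cases hi : (i : ℕ) = j
      · simp only [C, if_pos hi, ih]
      · simp only [C, if_neg hi, labelLaw_normalTree_ball, mul_one]
    rw [hset, measure_iUnion hdisj hS, tsum_congr hmS,
      -- Indices `j ≥ k` have mass zero. For `j < k` only the sub-tree `j` contributes a generation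
      -- size, and these sizes add up to that of `t`.
      tsum_eq_sum (s := Finset.range k) fun j hj => by
        rw [if_neg (by simpa using hj), zero_mul],
      Finset.sum_range, weight, genSize, Nat.cast_sum, Finset.mul_sum]
    refine Finset.sum_congr rfl fun j _ => ?_
    rw [if_pos j.2, Finset.prod_mul_distrib, mul_assoc]
    congr 2
    simp only [Fin.val_inj]
    rw [Finset.prod_ite_eq' Finset.univ j]
    simp

theorem kestenLaw_ball (p : PMF ℕ) (hp : IsCritical p) (h : ℕ) (t : LFTree) :
    (kestenLaw p hp : Measure LFTree) (ball h t) = weight p h t * genSize h t := by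
  rw [← labelLaw_kestenTree_ball p hp]
  exact Measure.map_apply measurable_kestenTree (measurableSet_ball h t)

end GWTree

end

/-! ### The two conditional limits. -/

theorem mainTheorem1 (p : PMF ℕ) (hcrit : GWTree.IsCritical p) (hunb : GWTree.IsUnbounded p)
    {Ω : Type*} [MeasurableSpace Ω] (P : Measure Ω) [IsProbabilityMeasure P]
    (τ : Ω → GWTree.LFTree) (hτ : GWTree.IsGaltonWatson p P τ) :
    (∃ hpos : ∀ n : {n : ℕ // 0 < p n}, P {ω | (τ ω).maxOutDegree = (n : ℕ)} ≠ 0,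
      Tendsto (fun n : {n : ℕ // 0 < p n} =>
          GWTree.condLaw P τ hτ.measurable {ω | (τ ω).maxOutDegree = (n : ℕ)} (hpos n))
        atTop (𝓝 (GWTree.kestenLaw p hcrit))) ∧
    (∃ hpos : ∀ n : ℕ, P {ω | (n : ℕ∞) < (τ ω).maxOutDegree} ≠ 0,
      Tendsto (fun n : ℕ =>
          GWTree.condLaw P τ hτ.measurable {ω | (n : ℕ∞) < (τ ω).maxOutDegree} (hpos n))
        atTop (𝓝 (GWTree.kestenLaw p hcrit))) := by
  have hpos1 : ∀ n : {n : ℕ // 0 < p n}, P {ω | (τ ω).maxOutDegree = (n : ℕ)} ≠ 0 :=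
    fun n => hτ.measure_maxOutDegree_eq_pos hcrit hunb n.2
  have hpos2 : ∀ n : ℕ, P {ω | (n : ℕ∞) < (τ ω).maxOutDegree} ≠ 0 := by
    intro n h0
    obtain ⟨m, hm, hpm⟩ := hunb.exists_gt n
    refine hpos1 ⟨m, hpm⟩ (measure_mono_null (fun ω hω => ?_) h0)
    change (n : ℕ∞) < (τ ω).maxOutDegree
    rw [show (τ ω).maxOutDegree = (m : ℕ) from hω]
    exact_mod_cast hm
  have hval : Tendsto (fun n : {n : ℕ // 0 < p n} => (n : ℕ)) atTop atTop := by
    refine Monotone.tendsto_atTop_atTop (fun _ _ h => h) fun b => ?_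
    obtain ⟨m, hm, hpm⟩ := hunb.exists_gt b
    exact ⟨⟨m, hpm⟩, hm.le⟩
  refine ⟨⟨hpos1, GWTree.LFTree.tendsto_of_tendsto_ball fun h t => ?_⟩,
    ⟨hpos2, GWTree.LFTree.tendsto_of_tendsto_ball fun h t => ?_⟩⟩
  · rw [GWTree.kestenLaw_ball]
    -- For integers, `M = n` means `n - 1 < M ≤ n`. Truncated subtraction spoils this at `n = 0`, so
    -- the identity of events is only claimed eventually.
    refine hτ.tendsto_condLaw hcrit hunb hpos1 (a := fun n => (n : ℕ) - 1)
      (b := fun n => ((n : ℕ) : ℕ∞)) ?_ (fun n => by exact_mod_cast Nat.sub_le _ _) ?_ h t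
    · exact (tendsto_sub_atTop_nat 1).comp hval
    · filter_upwards [hval.eventually_ge_atTop 1] with n hn
      ext ω
      change _ = _ ↔ _ < _ ∧ _ ≤ _
      obtain ⟨m, hm⟩ := Nat.exists_eq_add_of_le' hn
      rw [hm, Nat.add_sub_cancel, Nat.cast_add, Nat.cast_one, ← ENat.add_one_le_iff (by simp)]
      exact ⟨fun e => ⟨e.ge, e.le⟩, fun e => le_antisymm e.2 e.1⟩
  · rw [GWTree.kestenLaw_ball]
    -- The upper end `⊤` keeps the null event `M = ∞`, as in the conditioning `M > n`.
    refine hτ.tendsto_condLaw hcrit hunb hpos2 (a := id) (b := fun _ => ⊤) tendsto_id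
      (fun _ => le_top) (Eventually.of_forall fun n => ?_) h t
    simp
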